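/- Consider terms in one variable $x$ and one binary operation $\circ$. Let $=_{LD}$ be the congruence on terms generated by the pairs $\big(T_1\circ(T_2\circ T_3),\,(T_1\circ T_2)\circ(T_1\circ T_3)\big)$. Put $x^{[1]}=x$ and $x^{[n+1]}=x\circ x^{[n]}$. Define $S\otimes x=S\circ x$, $S\otimes(T_0\circ T_1)=(S\otimes T_0)\circ(S\otimes T_1)$, $\partial x=x$ and $\partial(T_0\circ T_1)=\partial T_0\otimes\partial T_1$. The iterated left subterms of $T$ are $T$ itself and, when $T=T_0\circ T_1$, the iterated left subterms of $T_0$. Nodes of (the binary tree of) a term have binary addresses, $0$ meaning left and $1$ meaning right. For a leaf address $\alpha$ of $T$, the cut $\mathrm{cut}(T,\alpha)$ is what remains of $T$ when everything to the right of that leaf is removed: $\mathrm{cut}(x,\emptyset)=x$, $\mathrm{cut}(T_0\circ T_1,0\alpha)=\mathrm{cut}(T_0,\alpha)$, $\mathrm{cut}(T_0\circ T_1,1\alpha)=T_0\circ\mathrm{cut}(T_1,\alpha)$. Write $\alpha\ggg\beta$ if $\alpha=\gamma1^p0\varepsilon$ and $\beta=\gamma0\delta$ for some $p\ge1$ and some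 addresses $\gamma,\delta,\varepsilon$. A descent in $T$ is a finite sequence $(\alpha_1,\dots,\alpha_m)$, $m\ge1$, of leaf addresses of $T$ such that $\alpha_i\ggg\alpha_{i+1}$ for every $i<m$. Call a term $N$ normal (respectively cut-normal) if, for some $p\ge0$, it is an iterated left subterm (respectively a cut) of $\partial^p x^{[n]}$ for some $n\ge1$, and no term that is $LD$-equivalent to $N$ is an iterated left subterm (respectively a cut) of $\partial^q x^{[m]}$ for any $q<p$ and $m\ge1$. Then the following hold. (i) Every term is $LD$-equivalent to a unique normal term. (ii) Every term is $LD$-equivalent to a unique cut-normal term. (iii) The iterated left subterms of a term $T$ are exactly the cuts of $T$ at leaf addresses of the form $0^r1^s$ with $r,s\ge0$. (iv) For $n\ge1$, the cuts of $x^{[n]}$ are exactly the terms $x^{[i]}$ with $1\le i\le n$. (v) For every term $T$, distinct leaves of $T$ have distinct cuts. (vi) For every term $T$, there is a unique bijection $\phi$ from the leaf addresses of $\partial T$ to the descents of $T$ such that, for every leaf address $\alpha$ of $\partial T$, if $\phi(\alpha)=(\alpha_1,\dots,\alpha_m)$, then $$\mathrm{cut}(\partial T,\alpha)=_{LD}\mathrm{cut}(T,\alpha_1)\circ\big(\mathrm{cut}(T,\alpha_2)\circ\cdots(\mathrm{cut}(T,\alpha_{m-1})\circ\mathrm{cut}(T,\alpha_m))\cdots\big).$$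 -/

import Mathlib

namespace SelfDistr

/-- Terms in the single variable `x`: the absolutely free binary algebra on one generator. -/
abbrev Tm : Type := FreeMagma Unit

/-- The variable `x`. -/
def var : Tm := FreeMagma.of ()

/-- LD-equivalence: the least congruence on terms that contains all pairs
`(t₁ * (t₂ * t₃), (t₁ * t₂) * (t₁ * t₃))`. -/
def ldCon : Con Tm :=
  conGen fun s t => ∃ t₁ t₂ t₃ : Tm, s = t₁ * (t₂ * t₃) ∧ t = (t₁ * t₂) * (t₁ * t₃)

/-- The right power `x^[n]`, with `x^[1] = x` and `x^[n+1] = x * x^[n]` for `n ≥ 1`.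
The value at `0` is irrelevant. -/
def rightPow : ℕ → Tm
  | 0 => var
  | 1 => var
  | n + 2 => var * rightPow (n + 1)

/-- The operation `S ⊗ T`, which replaces every occurrence of `x` in `T` by `S * x`. -/
def otimes (S : Tm) : Tm → Tm
  | FreeMagma.of a => S * FreeMagma.of a
  | FreeMagma.mul T₀ T₁ => otimes S T₀ * otimes S T₁

/-- The derived term `∂T`. -/
def der : Tm → Tm
  | FreeMagma.of a => FreeMagma.of a
  | FreeMagma.mul T₀ T₁ => otimes (der T₀) (der T₁)

/-- The term `∂^p x^[n]`. -/
def derPow (p n : ℕ) : Tm := der^[p] (rightPow n)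

/-- `S` is an iterated left subterm of `T`, that is, `T = (⋯((S * U₁) * U₂)⋯) * Uᵣ` for some
`r ≥ 0` (so `T` itself is allowed). -/
def IsIterLeftSubterm (S T : Tm) : Prop :=
  Relation.ReflTransGen (fun A B : Tm => ∃ U : Tm, B = A * U) S T

/-- Binary addresses; `false` stands for `0` (left) and `true` for `1` (right). -/
abbrev Addr : Type := List Bool

/-- `α` is the address of a leaf of the binary tree `T`. -/
def IsLeaf : Tm → Addr → Prop
  | FreeMagma.of _, α => α = []
  | FreeMagma.mul _ _, [] => False
  | FreeMagma.mul T₀ _, false :: α => IsLeaf T₀ α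
  | FreeMagma.mul _ T₁, true :: α => IsLeaf T₁ α

/-- The cut of `T` at the leaf with address `α`: what remains of `T` when everything on the right
of that leaf is removed.  In (right) Polish notation it is the prefix of `T` that ends with the
letter of this leaf, completed by the operation symbols needed to make it a term.
Values at addresses that are not leaves are irrelevant. -/
def cut : Tm → Addr → Tm
  | FreeMagma.of a, _ => FreeMagma.of a
  | FreeMagma.mul T₀ T₁, [] => T₀ * T₁
  | FreeMagma.mul T₀ _, false :: α => cut T₀ α
  | FreeMagma.mul T₀ T₁, true :: α => T₀ * cut T₁ α

/-- The relation `α ≫ β`: `α = γ 1^p 0 ε` and `β = γ 0 δ` for some `p ≥ 1` and addresses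
`γ, δ, ε`. -/
def Descends (α β : Addr) : Prop :=
  ∃ (γ δ ε : Addr) (p : ℕ), 1 ≤ p ∧
    α = γ ++ List.replicate p true ++ false :: ε ∧ β = γ ++ false :: δ

/-- A descent in `T`: a nonempty finite sequence of leaf addresses, each one `≫` the next one. -/
def IsDescent (T : Tm) (l : List Addr) : Prop :=
  l ≠ [] ∧ (∀ α ∈ l, IsLeaf T α) ∧ l.IsChain Descends

/-- The right-bracketed product `t₁ * (t₂ * (⋯ * tₘ))` of a nonempty list.
The value at the empty list is irrelevant. -/
def rightProd : List Tm → Tm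
  | [] => var
  | [t] => t
  | t :: u :: l => t * rightProd (u :: l)

/-- `T` is an iterated left subterm of `∂^p x^[n]` for some `n ≥ 1`. -/
def OccursLeft (p : ℕ) (T : Tm) : Prop :=
  ∃ n : ℕ, 1 ≤ n ∧ IsIterLeftSubterm T (derPow p n)

/-- `T` is a cut of `∂^p x^[n]` for some `n ≥ 1`. -/
def OccursCut (p : ℕ) (T : Tm) : Prop :=
  ∃ n : ℕ, 1 ≤ n ∧ ∃ α : Addr, IsLeaf (derPow p n) α ∧ cut (derPow p n) α = T

/-- Normal terms: iterated left subterms of some `∂^p x^[n]`, with `p` minimal for the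
LD-class of the term. -/
def IsNormal (T : Tm) : Prop :=
  ∃ p : ℕ, OccursLeft p T ∧ ∀ (q : ℕ) (S : Tm), ldCon T S → OccursLeft q S → p ≤ q

/-- The counterpart of `IsNormal` with arbitrary cuts in place of iterated left subterms. -/
def IsCutNormal (T : Tm) : Prop :=
  ∃ p : ℕ, OccursCut p T ∧ ∀ (q : ℕ) (S : Tm), ldCon T S → OccursCut q S → p ≤ q

end SelfDistr

/-!
The uniqueness statements rest on two facts about left division. First, for leaves `α`, `β` of a
term `T`, with `α` on the left of `β`, the term `cut T α` is an iterated left divisor of `cut T β`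
up to LD-equivalence (`pairwise_leftDiv_cut`), because left multiplication is an endomorphism.
Second, no term is a proper iterated left divisor of itself up to LD-equivalence
(`LeftDiv.not_ldCon`). Hence cuts of one term at different leaves are never LD-equivalent
(`eq_of_ldCon_cut`).

The second fact needs a self-distributive structure in which left division has no cycle. On the
braid group `B_∞` the bracket `a ▹ b = a * sh b * σ₁ * (sh a)⁻¹` is self-distributive, and if `c` is
obtained from `a` by brackets `(⋯((a ▹ b₁) ▹ b₂)⋯) ▹ bᵣ` with `r ≥ 1`, then `a⁻¹ * c` has a word in
which `σ₁` occurs and `σ₁⁻¹` does not. To see that such braids are nontrivial, the group is made to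
act on sequences of pairs of positive rationals: `σ₁` acts on the first two pairs by a solution of
the Yang–Baxter equation, the subtraction-free version of Dynnikov's piecewise linear formulas. It
increases the first number of the first pair, and shifted braids do not touch it
(`LeftDiv.increasesHead`).

Existence of normal terms comes from confluence: the terms `∂^p T` are cofinal among the
LD-expansions of the terms in the class of `T` (`exists_expands_der_iterate`). Since
`T * x^[n]` and `x^[n+1]` are LD-equivalent for large `n`, some `∂^p x^[n+1]` is an expansion of
`T * x^[n]`, and it has an iterated left subterm in the class of `T` (`exists_occursLeft`). For
uniqueness, all cuts of terms `∂^p x^[n]` with the same `p` are cuts of a single term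
(`OccursCut.eq_of_ldCon`).

For the cuts of `∂T`, a leaf is described by its context, the list `A₁, …, Aₖ` such that the cut at
this leaf is `A₁ * (A₂ * (⋯ * (Aₖ * x)))`. The cut at a leaf that is not the last one is the right
product of the context of the next leaf (`map_cut_leaves`). Contexts in `S ⊗ T` and descents in
`T₀ * T₁` obey the same recursion, and by induction the context of a leaf of `∂T` acts on all terms
as the list of cuts along the corresponding descent does (`forall₂_contexts_innerDescents`); this
stronger statement is what makes the induction work for the right products.
-/

namespace SelfDistr

/-! ### Left division of terms has no cycle -/

/-- In a group with an endomorphism `sh` and an element `σ` that satisfy the relations of the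
shift and of the first generator of the braid group `B_∞`, the bracket
`a ▹ b = a * sh b * σ * (sh a)⁻¹` is left self-distributive. -/
def bracket {G : Type*} [Group G] (sh : G →* G) (σ a b : G) : G :=
  a * sh b * σ * (sh a)⁻¹

theorem bracket_self_distrib {G : Type*} [Group G] {sh : G →* G} {σ : G}
    (hcomm : ∀ a, σ * sh (sh a) = sh (sh a) * σ)
    (hbraid : σ * sh σ * σ = sh σ * σ * sh σ) (a b c : G) :
    bracket sh σ a (bracket sh σ b c) =
      bracket sh σ (bracket sh σ a b) (bracket sh σ a c) := by
  have hcomm' : ∀ a, (sh (sh a))⁻¹ * σ = σ * (sh (sh a))⁻¹ := fun a => by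
    rw [← map_inv, ← map_inv, hcomm]
  have key : σ * (sh (sh c) * (sh σ * ((sh (sh a))⁻¹ * (σ * (sh (sh a) * (sh σ)⁻¹))))) =
      sh (sh c) * (sh σ * σ) := by
    calc _ = (σ * sh (sh c)) * sh σ * ((sh (sh a))⁻¹ * σ) * sh (sh a) * (sh σ)⁻¹ := by group
      _ = sh (sh c) * (σ * sh σ * σ) * (sh σ)⁻¹ := by rw [hcomm, hcomm']; group
      _ = _ := by rw [hbraid]; group
  calc bracket sh σ a (bracket sh σ b c)
      = a * sh b * (sh (sh c) * sh σ * ((sh (sh b))⁻¹ * σ)) * (sh a)⁻¹ := by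
        simp only [bracket, map_mul, map_inv]; group
    _ = a * sh b * (sh (sh c) * (sh σ * σ)) * (sh (sh b))⁻¹ * (sh a)⁻¹ := by
        rw [hcomm']; group
    _ = _ := by
        rw [← key]; simp only [bracket, map_mul, map_inv]; group

/-- Pairs of positive rationals: the colours of strands in the action of the braid group. -/
abbrev PosPair : Type := {p : ℚ × ℚ // 0 < p.1 ∧ 0 < p.2}

/-- The set-theoretic solution of the Yang–Baxter equation on pairs of positive numbers by which
the first braid generator acts. It is the subtraction-free form of Dynnikov's formulas. -/
def yangBaxter (p q : PosPair) : PosPair × PosPair :=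
  (⟨(p.1.1 + p.1.2 * (p.1.1 + q.1.1),
      p.1.2 * q.1.2 * q.1.1 / (p.1.2 * q.1.1 + p.1.1 * (1 + p.1.2) * (1 + q.1.2))), by
      obtain ⟨⟨a, b⟩, ha, hb⟩ := p; obtain ⟨⟨c, d⟩, hc, hd⟩ := q
      dsimp only at *; constructor <;> positivity⟩,
    ⟨(p.1.1 * q.1.1 * q.1.2 / (p.1.1 + q.1.1 + p.1.1 * q.1.2),
      p.1.2 + p.1.1 * (1 + p.1.2) * (1 + q.1.2) / q.1.1), by
      obtain ⟨⟨a, b⟩, ha, hb⟩ := p; obtain ⟨⟨c, d⟩, hc, hd⟩ := q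
      dsimp only at *; constructor <;> positivity⟩)

/-- The inversion of the first entry of a pair; it conjugates `yangBaxter` into its inverse. -/
def invFst (p : PosPair) : PosPair :=
  ⟨(p.1.1⁻¹, p.1.2), by
    obtain ⟨⟨a, b⟩, ha, hb⟩ := p; dsimp only at *; constructor <;> positivity⟩

theorem invFst_invFst (p : PosPair) : invFst (invFst p) = p := by
  simp [invFst]

/-- The inverse of `yangBaxter`, obtained by conjugation with `invFst`. -/
def yangBaxterInv (p q : PosPair) : PosPair × PosPair :=
  (yangBaxter (invFst p) (invFst q)).map invFst invFst

theorem yangBaxterInv_yangBaxter (p q : PosPair) :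
    yangBaxterInv (yangBaxter p q).1 (yangBaxter p q).2 = (p, q) := by
  obtain ⟨⟨a, b⟩, ha, hb⟩ := p
  obtain ⟨⟨c, d⟩, hc, hd⟩ := q
  dsimp only at ha hb hc hd
  simp only [yangBaxterInv, yangBaxter, invFst, Prod.map, Prod.mk.injEq, Subtype.mk.injEq]
  refine ⟨⟨?_, ?_⟩, ?_, ?_⟩ <;> field_simp <;> ring

theorem yangBaxter_yangBaxterInv (p q : PosPair) :
    yangBaxter (yangBaxterInv p q).1 (yangBaxterInv p q).2 = (p, q) := by
  have h := yangBaxterInv_yangBaxter (invFst p) (invFst q)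
  simp only [yangBaxterInv, Prod.map, Prod.mk.injEq] at h ⊢
  have h1 := congrArg invFst h.1
  have h2 := congrArg invFst h.2
  simp only [invFst_invFst] at h1 h2
  exact Prod.ext h1 h2


/-- `yangBaxter` preserves the product of the second entries. -/
theorem yangBaxter_snd_mul_snd (p q : PosPair) :
    (yangBaxter p q).1.1.2 * (yangBaxter p q).2.1.2 = p.1.2 * q.1.2 := by
  obtain ⟨⟨a, b⟩, ha, hb⟩ := p
  obtain ⟨⟨c, d⟩, hc, hd⟩ := q
  dsimp only at ha hb hc hd
  simp only [yangBaxter]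
  field_simp

set_option maxHeartbeats 1000000 in
/-- The first component of the Yang–Baxter equation. -/
theorem yangBaxter_braid_fst (p q r : PosPair) :
    (yangBaxter (yangBaxter p q).1 (yangBaxter (yangBaxter p q).2 r).1).1 =
      (yangBaxter p (yangBaxter q r).1).1 := by
  obtain ⟨⟨a, b⟩, ha, hb⟩ := p
  obtain ⟨⟨c, d⟩, hc, hd⟩ := q
  obtain ⟨⟨e, f⟩, he, hf⟩ := r
  dsimp only at ha hb hc hd he hf
  simp only [yangBaxter, Prod.mk.injEq, Subtype.mk.injEq]
  constructor <;> field_simp <;> ring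

set_option maxHeartbeats 1000000 in
/-- The third component of the Yang–Baxter equation. -/
theorem yangBaxter_braid_trd (p q r : PosPair) :
    (yangBaxter (yangBaxter p q).2 r).2 =
      (yangBaxter (yangBaxter p (yangBaxter q r).1).2 (yangBaxter q r).2).2 := by
  obtain ⟨⟨a, b⟩, ha, hb⟩ := p
  obtain ⟨⟨c, d⟩, hc, hd⟩ := q
  obtain ⟨⟨e, f⟩, he, hf⟩ := r
  dsimp only at ha hb hc hd he hf
  simp only [yangBaxter, Prod.mk.injEq, Subtype.mk.injEq]
  constructor <;> field_simp <;> ring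

/-- The middle component of the Yang–Baxter equation. The first entries are compared through
intermediate values in lowest terms; the second entries agree because the product of all second
entries is preserved. -/
theorem yangBaxter_braid_snd (p q r : PosPair) :
    (yangBaxter (yangBaxter p q).1 (yangBaxter (yangBaxter p q).2 r).1).2 =
      (yangBaxter (yangBaxter p (yangBaxter q r).1).2 (yangBaxter q r).2).1 := by
  refine Subtype.ext (Prod.ext ?_ ?_)
  · obtain ⟨⟨a, b⟩, ha, hb⟩ := p
    obtain ⟨⟨c, d⟩, hc, hd⟩ := q
    obtain ⟨⟨e, f⟩, he, hf⟩ := r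
    dsimp only at ha hb hc hd he hf
    simp only [yangBaxter]
    set D₁ := b * c + a * (1 + b) * (1 + d) with hD₁
    set D₂ := d * e + c * (1 + d) * (1 + f) with hD₂
    have pos₁ : 0 < D₁ := by positivity
    have pos₂ : 0 < D₂ := by positivity
    have e₀ : b + a * (1 + b) * (1 + d) / c = D₁ / c := by rw [hD₁]; field_simp
    have e₁ : a * c * d / (a + c + a * d) + D₁ / c * (a * c * d / (a + c + a * d) + e) =
        (a * c * d * (1 + b) + D₁ * e) / c := by
      rw [hD₁]; field_simp; ring
    have e₂ : D₁ / c * f * e /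
        (D₁ / c * e + a * c * d / (a + c + a * d) * (1 + D₁ / c) * (1 + f)) =
        D₁ * e * f / (D₁ * e + a * c * d * (1 + b) * (1 + f)) := by
      have : 1 + D₁ / c = (1 + b) * (a + c + a * d) / c := by rw [hD₁]; field_simp; ring
      rw [this]; field_simp
    set g := c + d * (c + e) with hg
    have posg : 0 < g := by positivity
    have h₀ : 1 + d * f * e / D₂ = (1 + f) * g / D₂ := by rw [hD₂, hg]; field_simp; ring
    have e₃ : a * g * (d * f * e / D₂) / (a + g + a * (d * f * e / D₂)) =
        a * d * e * f / (D₂ + a * (1 + f)) := by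
      have : a + g + a * (d * f * e / D₂) = g * (D₂ + a * (1 + f)) / D₂ := by
        linear_combination a * h₀ + g * (div_self pos₂.ne').symm
      rw [this]; field_simp
    have e₄ : b + a * (1 + b) * (1 + d * f * e / D₂) / g =
        (b * D₂ + a * (1 + b) * (1 + f)) / D₂ := by
      rw [h₀]; field_simp
    have lhs : (a + b * (a + c)) * ((a * c * d * (1 + b) + D₁ * e) / c) *
        (D₁ * e * f / (D₁ * e + a * c * d * (1 + b) * (1 + f))) /
        (a + b * (a + c) + (a * c * d * (1 + b) + D₁ * e) / c + (a + b * (a + c)) *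
          (D₁ * e * f / (D₁ * e + a * c * d * (1 + b) * (1 + f)))) =
        e * f * (a + b * (a + c)) / (c + e + c * f) := by
      rw [hD₁]; field_simp; ring
    have rhs : a * d * e * f / (D₂ + a * (1 + f)) + (b * D₂ + a * (1 + b) * (1 + f)) / D₂ *
        (a * d * e * f / (D₂ + a * (1 + f)) + c * e * f / (c + e + c * f)) =
        e * f * (a + b * (a + c)) / (c + e + c * f) := by
      rw [hD₂]; field_simp; ring
    rw [e₀, e₁, e₂, e₃, e₄, lhs, rhs]
  · have h₁ := yangBaxter_snd_mul_snd p q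
    have h₂ := yangBaxter_snd_mul_snd (yangBaxter p q).2 r
    have h₃ := yangBaxter_snd_mul_snd (yangBaxter p q).1 (yangBaxter (yangBaxter p q).2 r).1
    have k₁ := yangBaxter_snd_mul_snd q r
    have k₂ := yangBaxter_snd_mul_snd p (yangBaxter q r).1
    have k₃ := yangBaxter_snd_mul_snd (yangBaxter p (yangBaxter q r).1).2 (yangBaxter q r).2
    rw [yangBaxter_braid_fst] at h₃
    rw [← yangBaxter_braid_trd] at k₃
    have pos₁ := (yangBaxter p (yangBaxter q r).1).1.2.2
    have pos₂ := (yangBaxter (yangBaxter p q).2 r).2.2.2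
    refine mul_left_cancel₀ pos₁.ne' (mul_right_cancel₀ pos₂.ne' ?_)
    linear_combination (yangBaxter (yangBaxter p q).2 r).2.1.2 * h₃ +
      (yangBaxter p q).1.1.2 * h₂ + r.1.2 * h₁ -
      (yangBaxter p (yangBaxter q r).1).1.1.2 * k₃ - (yangBaxter q r).2.1.2 * k₂ - p.1.2 * k₁

open Stream' in
/-- The endomorphism that makes a permutation of sequences act from the second entry on. -/
def shiftHom : Equiv.Perm (Stream' PosPair) →* Equiv.Perm (Stream' PosPair) where
  toFun f :=
    { toFun := fun s => cons s.head (f s.tail)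
      invFun := fun s => cons s.head (f.symm s.tail)
      left_inv := fun s => by simp [Stream'.eta]
      right_inv := fun s => by simp [Stream'.eta] }
  map_one' := Equiv.ext fun s => Stream'.eta s
  map_mul' f g := Equiv.ext fun s => by simp

open Stream' in
/-- The action of the first braid generator on sequences. -/
def braidGen : Equiv.Perm (Stream' PosPair) where
  toFun s := cons (yangBaxter s.head s.tail.head).1
    (cons (yangBaxter s.head s.tail.head).2 s.tail.tail)
  invFun s := cons (yangBaxterInv s.head s.tail.head).1
    (cons (yangBaxterInv s.head s.tail.head).2 s.tail.tail)
  left_inv s := by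
    simp only [Stream'.head_cons, Stream'.tail_cons, yangBaxterInv_yangBaxter, Stream'.eta]
  right_inv s := by
    simp only [Stream'.head_cons, Stream'.tail_cons, yangBaxter_yangBaxterInv, Stream'.eta]

theorem shiftHom_apply (f : Equiv.Perm (Stream' PosPair)) (s : Stream' PosPair) :
    shiftHom f s = Stream'.cons s.head (f s.tail) := rfl

theorem braidGen_apply (s : Stream' PosPair) :
    braidGen s = Stream'.cons (yangBaxter s.head s.tail.head).1
      (Stream'.cons (yangBaxter s.head s.tail.head).2 s.tail.tail) := rfl

theorem braidGen_comm (f : Equiv.Perm (Stream' PosPair)) :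
    braidGen * shiftHom (shiftHom f) = shiftHom (shiftHom f) * braidGen :=
  Equiv.ext fun s => by simp [shiftHom_apply, braidGen_apply]

theorem braidGen_braid :
    braidGen * shiftHom braidGen * braidGen =
      shiftHom braidGen * braidGen * shiftHom braidGen :=
  Equiv.ext fun s => by
    simp [shiftHom_apply, braidGen_apply, yangBaxter_braid_fst, yangBaxter_braid_snd,
      ← yangBaxter_braid_trd]

/-- The evaluation of terms under the bracket on permutations of sequences, with the variable sent
to `1`. -/
def braidEval : Tm → Equiv.Perm (Stream' PosPair)
  | FreeMagma.of _ => 1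
  | FreeMagma.mul T₀ T₁ => bracket shiftHom braidGen (braidEval T₀) (braidEval T₁)

theorem braidEval_mul (S T : Tm) :
    braidEval (S * T) = bracket shiftHom braidGen (braidEval S) (braidEval T) := rfl

theorem braidEval_eq {S T : Tm} (h : ldCon S T) : braidEval S = braidEval T := by
  induction h with
  | of S T h =>
    obtain ⟨A, B, C, rfl, rfl⟩ := h
    simp only [braidEval_mul]
    exact bracket_self_distrib braidGen_comm braidGen_braid _ _ _
  | refl => rfl
  | symm _ ih => exact ih.symm
  | trans _ _ ih₁ ih₂ => exact ih₁.trans ih₂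
  | mul _ _ ih₁ ih₂ =>
    rw [braidEval_mul, braidEval_mul, ih₁, ih₂]

/-- `f` increases the first number of the first pair of every sequence. All `σ₁`-positive braids,
that is, braids with a word in which `σ₁` occurs and `σ₁⁻¹` does not, act in this way. -/
def IncreasesHead (f : Equiv.Perm (Stream' PosPair)) : Prop :=
  ∀ s, s.head.1.1 < (f s).head.1.1

theorem IncreasesHead.mul {f g : Equiv.Perm (Stream' PosPair)} (hf : IncreasesHead f)
    (hg : IncreasesHead g) : IncreasesHead (f * g) := fun s =>
  (hg s).trans (hf (g s))

theorem increasesHead_shift_mul_braidGen_mul_shift (f g : Equiv.Perm (Stream' PosPair)) :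
    IncreasesHead (shiftHom f * braidGen * shiftHom g) := fun s => by
  have h₀ := s.head.2.1
  have h₁ := s.head.2.2
  have h₂ := (g s.tail).head.2.1
  simp only [Equiv.Perm.mul_apply, shiftHom_apply, braidGen_apply, Stream'.head_cons,
    Stream'.tail_cons, yangBaxter]
  have := mul_pos h₁ (add_pos h₀ h₂)
  linarith

/-- `S` is a proper iterated left divisor of `T` up to LD-equivalence. -/
def LeftDiv (S T : Tm) : Prop :=
  Relation.TransGen (fun A B : Tm => ∃ U : Tm, ldCon (A * U) B) S T

/-- If `S` divides `T`, then the values of `S` and `T` differ by a `σ₁`-positive braid on the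
right. -/
theorem LeftDiv.increasesHead {S T : Tm} (h : LeftDiv S T) :
    IncreasesHead ((braidEval S)⁻¹ * braidEval T) := by
  have step : ∀ {A B : Tm}, (∃ U : Tm, ldCon (A * U) B) →
      IncreasesHead ((braidEval A)⁻¹ * braidEval B) := by
    rintro A B ⟨U, hU⟩
    rw [← braidEval_eq hU, braidEval_mul, bracket, ← map_inv, mul_assoc, mul_assoc,
      inv_mul_cancel_left, ← mul_assoc]
    exact increasesHead_shift_mul_braidGen_mul_shift _ _
  induction h with
  | single h => exact step h
  | tail _ h ih =>
    have := ih.mul (step h)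
    rwa [mul_assoc, mul_inv_cancel_left] at this

theorem LeftDiv.not_ldCon {S T : Tm} (h : LeftDiv S T) : ¬ ldCon S T := fun hST => by
  have := h.increasesHead
  rw [braidEval_eq hST, inv_mul_cancel] at this
  exact lt_irrefl _ (this (Stream'.const ⟨(1, 1), one_pos, one_pos⟩))

/-! ### Expansions and the derived term -/

/-- Structural induction on terms, phrased with `var` and `*` instead of the constructors of
`FreeMagma`. -/
@[elab_as_elim]
theorem termInduction {P : Tm → Prop} (T : Tm) (hvar : P var)
    (hmul : ∀ T₀ T₁, P T₀ → P T₁ → P (T₀ * T₁)) : P T :=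
  match T with
  | FreeMagma.of _ => hvar
  | FreeMagma.mul T₀ T₁ =>
    hmul T₀ T₁ (termInduction T₀ hvar hmul) (termInduction T₁ hvar hmul)

theorem otimes_mul (S T₀ T₁ : Tm) : otimes S (T₀ * T₁) = otimes S T₀ * otimes S T₁ := rfl

theorem der_mul (T₀ T₁ : Tm) : der (T₀ * T₁) = otimes (der T₀) (der T₁) := rfl

/-- One application of left self-distributivity to a subterm, in the expanding direction. -/
inductive ExpandStep : Tm → Tm → Prop
  | dist (A B C : Tm) : ExpandStep (A * (B * C)) ((A * B) * (A * C))
  | left {S S' : Tm} (T : Tm) (h : ExpandStep S S') : ExpandStep (S * T) (S' * T)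
  | right (S : Tm) {T T' : Tm} (h : ExpandStep T T') : ExpandStep (S * T) (S * T')

/-- `T` is an LD-expansion of `S`. -/
def Expands : Tm → Tm → Prop := Relation.ReflTransGen ExpandStep

theorem Expands.refl (T : Tm) : Expands T T := Relation.ReflTransGen.refl

theorem Expands.trans {R S T : Tm} (h : Expands R S) (h' : Expands S T) : Expands R T :=
  Relation.ReflTransGen.trans h h'

theorem ExpandStep.expands {S T : Tm} (h : ExpandStep S T) : Expands S T :=
  Relation.ReflTransGen.single h

theorem Expands.mul {S S' T T' : Tm} (h : Expands S S') (h' : Expands T T') :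
    Expands (S * T) (S' * T') :=
  (Relation.ReflTransGen.lift (· * T) (fun _ _ h => ExpandStep.left T h) _ _ h).trans
    (Relation.ReflTransGen.lift (S' * ·) (fun _ _ h => ExpandStep.right S' h) _ _ h')

theorem ldCon_dist (A B C : Tm) : ldCon (A * (B * C)) ((A * B) * (A * C)) :=
  ConGen.Rel.of _ _ ⟨A, B, C, rfl, rfl⟩

theorem ExpandStep.ldCon {S T : Tm} (h : ExpandStep S T) : ldCon S T := by
  induction h with
  | dist A B C => exact ldCon_dist A B C
  | left T _ ih => exact SelfDistr.ldCon.mul ih (SelfDistr.ldCon.refl T)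
  | right S _ ih => exact SelfDistr.ldCon.mul (SelfDistr.ldCon.refl S) ih

theorem Expands.ldCon {S T : Tm} (h : Expands S T) : ldCon S T := by
  induction h with
  | refl => exact SelfDistr.ldCon.refl S
  | tail _ h ih => exact SelfDistr.ldCon.trans ih h.ldCon

theorem mul_expands_otimes (S T : Tm) : Expands (S * T) (otimes S T) := by
  refine termInduction T (Expands.refl _) fun T₀ T₁ ih₀ ih₁ => ?_
  exact (ExpandStep.dist S T₀ T₁).expands.trans (ih₀.mul ih₁)

theorem Expands.otimes_right (S : Tm) {T T' : Tm} (h : Expands T T') :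
    Expands (otimes S T) (otimes S T') := by
  refine Relation.ReflTransGen.lift (otimes S) (fun A B h => ?_) _ _ h
  induction h with
  | dist A B C => exact ExpandStep.dist _ _ _
  | left T _ ih => exact ExpandStep.left _ ih
  | right S _ ih => exact ExpandStep.right _ ih

theorem Expands.otimes_left {S S' : Tm} (h : Expands S S') (T : Tm) :
    Expands (otimes S T) (otimes S' T) :=
  termInduction T (h.mul (Expands.refl _)) fun _ _ ih₀ ih₁ => ih₀.mul ih₁

theorem expands_der (T : Tm) : Expands T (der T) :=
  termInduction T (Expands.refl _) fun _ _ ih₀ ih₁ =>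
    (ih₀.mul ih₁).trans (mul_expands_otimes _ _)

theorem der_mul_der_expands (S T : Tm) : Expands (der S * der T) (der (S * T)) :=
  mul_expands_otimes _ _

/-- The derived term is a common expansion of all one-step expansions. -/
theorem ExpandStep.expands_der {S T : Tm} (h : ExpandStep S T) : Expands T (der S) := by
  induction h with
  | dist A B C =>
    have h := SelfDistr.expands_der
    exact ((((h A).mul (h B)).trans (mul_expands_otimes _ _)).mul
      (((h A).mul (h C)).trans (mul_expands_otimes _ _))).trans
      ((mul_expands_otimes (der B) (der C)).otimes_right (der A))
  | left T _ ih =>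
    exact (ih.mul (SelfDistr.expands_der T)).trans (der_mul_der_expands _ _)
  | right S _ ih =>
    exact ((SelfDistr.expands_der S).mul ih).trans (der_mul_der_expands _ _)

theorem otimes_otimes_expands (A B C : Tm) :
    Expands (otimes A (otimes B C)) (otimes (otimes A B) (otimes A C)) := by
  refine termInduction C ?_ fun _ _ ih₀ ih₁ => ih₀.mul ih₁
  exact mul_expands_otimes (otimes A B) (A * var)

theorem Expands.der {S T : Tm} (h : Expands S T) : Expands (der S) (der T) := by
  have step : ∀ {A B : Tm}, ExpandStep A B → Expands (SelfDistr.der A) (SelfDistr.der B) := by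
    intro A B h
    induction h with
    | dist A B C => exact otimes_otimes_expands _ _ _
    | left T _ ih => exact ih.otimes_left _
    | right S _ ih => exact ih.otimes_right _
  induction h with
  | refl => exact Expands.refl _
  | tail _ h ih => exact ih.trans (step h)

theorem Expands.der_iterate {S T : Tm} (h : Expands S T) (p : ℕ) :
    Expands (SelfDistr.der^[p] S) (SelfDistr.der^[p] T) := by
  induction p with
  | zero => exact h
  | succ p ih => simpa only [Function.iterate_succ_apply'] using ih.der

theorem expands_der_iterate (T : Tm) (p : ℕ) : Expands T (der^[p] T) := by
  induction p with
  | zero => exact Expands.refl T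
  | succ p ih =>
    rw [Function.iterate_succ_apply']
    exact ih.trans (expands_der _)

theorem expands_der_iterate_of_le (T : Tm) {p q : ℕ} (h : p ≤ q) :
    Expands (der^[p] T) (der^[q] T) := by
  obtain ⟨k, rfl⟩ := Nat.exists_eq_add_of_le' h
  rw [Function.iterate_add_apply]
  exact expands_der_iterate _ k

theorem der_iterate_mul_expands (S T : Tm) (p : ℕ) :
    Expands (der^[p] S * der^[p] T) (der^[p] (S * T)) := by
  induction p with
  | zero => exact Expands.refl _
  | succ p ih =>
    simp only [Function.iterate_succ_apply']
    exact (der_mul_der_expands _ _).trans ih.der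

theorem Expands.exists_expands_der_iterate {S T : Tm} (h : Expands S T) :
    ∃ p, Expands T (SelfDistr.der^[p] S) := by
  induction h with
  | refl => exact ⟨0, Expands.refl S⟩
  | tail _ h ih =>
    obtain ⟨p, hp⟩ := ih
    refine ⟨p + 1, h.expands_der.trans ?_⟩
    rw [Function.iterate_succ_apply']
    exact hp.der

/-- Confluence: every term of the LD-class of `S` expands to a common iterated derived term
of `S`. -/
theorem exists_expands_der_iterate {S T : Tm} (h : ldCon S T) :
    ∃ p, Expands T (der^[p] S) := by
  induction h with
  | of S T h =>
    obtain ⟨A, B, C, rfl, rfl⟩ := h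
    exact (ExpandStep.dist A B C).expands.exists_expands_der_iterate
  | refl S => exact ⟨0, Expands.refl S⟩
  | symm _ ih =>
    obtain ⟨p, hp⟩ := ih
    obtain ⟨k, hk⟩ := hp.exists_expands_der_iterate
    exact ⟨k, (expands_der_iterate _ p).trans hk⟩
  | trans _ _ ih₁ ih₂ =>
    obtain ⟨p, hp⟩ := ih₁
    obtain ⟨q, hq⟩ := ih₂
    refine ⟨q + p, hq.trans ?_⟩
    rw [Function.iterate_add_apply]
    exact hp.der_iterate q
  | mul _ _ ih₁ ih₂ =>
    obtain ⟨p, hp⟩ := ih₁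
    obtain ⟨q, hq⟩ := ih₂
    refine ⟨max p q, Expands.trans ?_ (der_iterate_mul_expands _ _ _)⟩
    exact (hp.trans (expands_der_iterate_of_le _ (le_max_left p q))).mul
      (hq.trans (expands_der_iterate_of_le _ (le_max_right p q)))

theorem rightPow_succ {n : ℕ} (h : 1 ≤ n) : rightPow (n + 1) = var * rightPow n := by
  obtain ⟨n, rfl⟩ := Nat.exists_eq_add_of_le' h
  rfl

/-- Large right powers absorb any term on their left. -/
theorem exists_mul_rightPow_ldCon (T : Tm) :
    ∃ k, ∀ n, k + 1 ≤ n → ldCon (T * rightPow n) (rightPow (n + 1)) := by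
  refine termInduction T ⟨0, fun n hn => ?_⟩ fun T₀ T₁ ih₀ ih₁ => ?_
  · rw [rightPow_succ hn]
    exact ldCon.refl _
  · obtain ⟨k₀, h₀⟩ := ih₀
    obtain ⟨k₁, h₁⟩ := ih₁
    refine ⟨max k₀ k₁ + 1, fun n hn => ?_⟩
    obtain ⟨n, rfl⟩ := Nat.exists_eq_add_of_le' (show 1 ≤ n by omega)
    have e₀ := h₀ n (by omega)
    have e₁ := h₁ n (by omega)
    have e₂ := h₀ (n + 1) (by omega)
    exact ldCon.trans (ldCon.mul (ldCon.refl _) (ldCon.symm e₀))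
      (ldCon.trans (ldCon.symm (ldCon_dist T₀ T₁ (rightPow n)))
        (ldCon.trans (ldCon.mul (ldCon.refl _) e₁) e₂))

theorem isIterLeftSubterm_mul_iff {A B U : Tm} :
    IsIterLeftSubterm A (B * U) ↔ A = B * U ∨ IsIterLeftSubterm A B := by
  constructor
  · intro h
    rcases Relation.ReflTransGen.cases_tail h with h | ⟨C, hC, V, hV⟩
    · exact Or.inl h.symm
    · injection hV with h₁ h₂
      exact Or.inr (h₁ ▸ hC)
  · rintro (rfl | h)
    · exact Relation.ReflTransGen.refl
    · exact Relation.ReflTransGen.tail h ⟨U, rfl⟩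

theorem IsIterLeftSubterm.mul_right {A B : Tm} (h : IsIterLeftSubterm A B) (U : Tm) :
    IsIterLeftSubterm A (B * U) :=
  isIterLeftSubterm_mul_iff.2 (Or.inr h)

theorem ExpandStep.exists_isIterLeftSubterm {S T : Tm} (h : ExpandStep S T) :
    ∀ A, IsIterLeftSubterm A S → ∃ B, IsIterLeftSubterm B T ∧ SelfDistr.ldCon A B := by
  induction h with
  | dist A B C =>
    intro D hD
    rcases isIterLeftSubterm_mul_iff.1 hD with rfl | hD
    · exact ⟨_, Relation.ReflTransGen.refl, ldCon_dist A B C⟩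
    · exact ⟨D, (hD.mul_right B).mul_right _, SelfDistr.ldCon.refl D⟩
  | left T h ih =>
    intro D hD
    rcases isIterLeftSubterm_mul_iff.1 hD with rfl | hD
    · exact ⟨_, Relation.ReflTransGen.refl, (h.left T).ldCon⟩
    · obtain ⟨B, hB, hDB⟩ := ih D hD
      exact ⟨B, hB.mul_right T, hDB⟩
  | right S h ih =>
    intro D hD
    rcases isIterLeftSubterm_mul_iff.1 hD with rfl | hD
    · exact ⟨_, Relation.ReflTransGen.refl, (h.right S).ldCon⟩
    · exact ⟨D, hD.mul_right _, SelfDistr.ldCon.refl D⟩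

/-- Iterated left subterms survive, up to LD-equivalence, in every expansion. -/
theorem Expands.exists_isIterLeftSubterm {S T : Tm} (h : Expands S T) {A : Tm}
    (hA : IsIterLeftSubterm A S) :
    ∃ B, IsIterLeftSubterm B T ∧ SelfDistr.ldCon A B := by
  induction h with
  | refl => exact ⟨A, hA, SelfDistr.ldCon.refl A⟩
  | tail _ h ih =>
    obtain ⟨B, hB, hAB⟩ := ih
    obtain ⟨C, hC, hBC⟩ := h.exists_isIterLeftSubterm B hB
    exact ⟨C, hC, SelfDistr.ldCon.trans hAB hBC⟩

/-- For large `n`, the terms `T * x^[n]` and `x^[n+1]` are LD-equivalent, so that some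
`∂^p x^[n+1]` expands `T * x^[n]`, and it inherits the left subterm `T`. -/
theorem exists_occursLeft (T : Tm) : ∃ p S, ldCon T S ∧ OccursLeft p S := by
  obtain ⟨k, hk⟩ := exists_mul_rightPow_ldCon T
  obtain ⟨p, hp⟩ := exists_expands_der_iterate (ldCon.symm (hk (k + 1) le_rfl))
  obtain ⟨S, hS, hTS⟩ := hp.exists_isIterLeftSubterm
    (IsIterLeftSubterm.mul_right Relation.ReflTransGen.refl (rightPow (k + 1)))
  exact ⟨p, S, hTS, k + 2, by omega, hS⟩

/-! ### Cuts -/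

theorem isLeaf_mul_iff {T₀ T₁ : Tm} {α : Addr} : IsLeaf (T₀ * T₁) α ↔
    (∃ β, α = false :: β ∧ IsLeaf T₀ β) ∨ ∃ β, α = true :: β ∧ IsLeaf T₁ β := by
  rcases α with _ | ⟨_ | _, α⟩
  · exact ⟨False.elim, by simp⟩
  · show IsLeaf T₀ α ↔ _
    simp
  · show IsLeaf T₁ α ↔ _
    simp

theorem cut_mul_false (T₀ T₁ : Tm) (α : Addr) : cut (T₀ * T₁) (false :: α) = cut T₀ α := rfl

theorem cut_mul_true (T₀ T₁ : Tm) (α : Addr) :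
    cut (T₀ * T₁) (true :: α) = T₀ * cut T₁ α := rfl

/-- The addresses of the leaves, from left to right. -/
def leaves : Tm → List Addr
  | FreeMagma.of _ => [[]]
  | FreeMagma.mul T₀ T₁ => (leaves T₀).map (false :: ·) ++ (leaves T₁).map (true :: ·)

theorem leaves_mul (T₀ T₁ : Tm) :
    leaves (T₀ * T₁) = (leaves T₀).map (false :: ·) ++ (leaves T₁).map (true :: ·) := rfl

theorem mem_leaves {T : Tm} {α : Addr} : α ∈ leaves T ↔ IsLeaf T α := by
  induction T using termInduction generalizing α with
  | hvar => exact List.mem_singleton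
  | hmul T₀ T₁ ih₀ ih₁ =>
    rw [leaves_mul, List.mem_append, List.mem_map, List.mem_map, isLeaf_mul_iff]
    simp only [ih₀, ih₁, eq_comm, and_comm]

/-- The address of the rightmost leaf. -/
def rightmost : Tm → Addr
  | FreeMagma.of _ => []
  | FreeMagma.mul _ T₁ => true :: rightmost T₁

theorem rightmost_mul (T₀ T₁ : Tm) : rightmost (T₀ * T₁) = true :: rightmost T₁ := rfl

theorem isLeaf_rightmost (T : Tm) : IsLeaf T (rightmost T) :=
  termInduction T rfl fun _ _ _ ih => ih

theorem cut_rightmost (T : Tm) : cut T (rightmost T) = T :=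
  termInduction T rfl fun T₀ T₁ _ ih => by rw [rightmost_mul, cut_mul_true, ih]

theorem isLeaf_replicate_true_iff {T : Tm} {s : ℕ} :
    IsLeaf T (List.replicate s true) ↔ List.replicate s true = rightmost T := by
  induction T using termInduction generalizing s with
  | hvar => exact Iff.rfl
  | hmul T₀ T₁ _ ih =>
    rcases s with _ | s
    · exact ⟨False.elim, fun h => by cases h⟩
    · rw [List.replicate_succ, rightmost_mul, List.cons.injEq, ← ih, isLeaf_mul_iff]
      simp

theorem exists_replicate_eq_rightmost (T : Tm) : ∃ s, List.replicate s true = rightmost T := by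
  refine termInduction T ⟨0, rfl⟩ ?_
  rintro T₀ T₁ _ ⟨s, hs⟩
  exact ⟨s + 1, by rw [List.replicate_succ, hs, rightmost_mul]⟩

theorem isIterLeftSubterm_iff_cut {S T : Tm} : IsIterLeftSubterm S T ↔
    ∃ r s : ℕ, IsLeaf T (List.replicate r false ++ List.replicate s true) ∧
      cut T (List.replicate r false ++ List.replicate s true) = S := by
  constructor
  · refine termInduction T (fun h => ?_) fun T₀ T₁ ih _ h => ?_
    · rcases Relation.ReflTransGen.cases_tail h with h | ⟨C, _, U, h⟩
      · exact ⟨0, 0, rfl, h⟩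
      · cases h
    · rcases isIterLeftSubterm_mul_iff.1 h with rfl | h
      · obtain ⟨s, hs⟩ := exists_replicate_eq_rightmost (T₀ * T₁)
        refine ⟨0, s, ?_⟩
        rw [List.replicate_zero, List.nil_append, hs]
        exact ⟨isLeaf_rightmost _, cut_rightmost _⟩
      · obtain ⟨r, s, h⟩ := ih h
        exact ⟨r + 1, s, h⟩
  · rintro ⟨r, s, hl, rfl⟩
    induction r generalizing T with
    | zero =>
      rw [List.replicate_zero, List.nil_append] at hl ⊢
      rw [isLeaf_replicate_true_iff.1 hl, cut_rightmost]
      exact Relation.ReflTransGen.refl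
    | succ r ih =>
      rw [List.replicate_succ, List.cons_append] at hl ⊢
      revert hl
      refine termInduction T (fun h => ?_) fun T₀ T₁ _ _ h => ?_
      · cases h
      · exact (ih h).mul_right T₁

theorem LeftDiv.mul_left {S S' : Tm} (T : Tm) (h : LeftDiv S S') : LeftDiv (T * S) (T * S') := by
  refine Relation.TransGen.lift (T * ·) (fun A B h => ?_) _ _ h
  obtain ⟨U, hU⟩ := h
  exact ⟨T * U, ldCon.trans (ldCon.symm (ldCon_dist T A U)) (ldCon.mul (ldCon.refl T) hU)⟩

theorem LeftDiv.trans {R S T : Tm} (h : LeftDiv R S) (h' : LeftDiv S T) : LeftDiv R T :=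
  Relation.TransGen.trans h h'

theorem leftDiv_mul (S T : Tm) : LeftDiv S (S * T) :=
  Relation.TransGen.single ⟨T, ldCon.refl _⟩

theorem cut_eq_or_leftDiv {T : Tm} {α : Addr} (hα : IsLeaf T α) :
    cut T α = T ∨ LeftDiv (cut T α) T := by
  induction T using termInduction generalizing α with
  | hvar => exact Or.inl rfl
  | hmul T₀ T₁ ih₀ ih₁ =>
    rcases isLeaf_mul_iff.1 hα with ⟨β, rfl, hβ⟩ | ⟨β, rfl, hβ⟩
    · rw [cut_mul_false]
      rcases ih₀ hβ with h | h
      · rw [h]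
        exact Or.inr (leftDiv_mul _ _)
      · exact Or.inr (h.trans (leftDiv_mul _ _))
    · rw [cut_mul_true]
      rcases ih₁ hβ with h | h
      · exact Or.inl (by rw [h])
      · exact Or.inr (h.mul_left T₀)

/-- From left to right, the cuts increase for the left division order. -/
theorem pairwise_leftDiv_cut (T : Tm) :
    (leaves T).Pairwise fun α β => LeftDiv (cut T α) (cut T β) := by
  refine termInduction T (List.pairwise_singleton _ _) fun T₀ T₁ ih₀ ih₁ => ?_
  rw [leaves_mul, List.pairwise_append, List.pairwise_map, List.pairwise_map]
  refine ⟨ih₀, ih₁.imp fun h => h.mul_left T₀, ?_⟩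
  simp only [List.mem_map, mem_leaves]
  rintro _ ⟨α, hα, rfl⟩ _ ⟨β, _, rfl⟩
  rw [cut_mul_false, cut_mul_true]
  rcases cut_eq_or_leftDiv hα with h | h
  · rw [h]
    exact leftDiv_mul _ _
  · exact h.trans (leftDiv_mul _ _)

theorem eq_of_ldCon_cut {T : Tm} {α β : Addr} (hα : IsLeaf T α) (hβ : IsLeaf T β)
    (h : ldCon (cut T α) (cut T β)) : α = β := by
  have key : ∀ α ∈ leaves T, ∀ β ∈ leaves T,
      ¬ ldCon (cut T α) (cut T β) ∨ α = β := by
    intro α hα β hβ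
    refine List.Pairwise.forall_of_forall_of_flip
      (R := fun α β => ¬ ldCon (cut T α) (cut T β) ∨ α = β) (fun _ _ => Or.inr rfl)
      ((pairwise_leftDiv_cut T).imp fun h => Or.inl h.not_ldCon)
      ((pairwise_leftDiv_cut T).imp fun h => Or.inl fun h' => h.not_ldCon (ldCon.symm h'))
      hα hβ
  exact (key α (mem_leaves.2 hα) β (mem_leaves.2 hβ)).resolve_left (not_not_intro h)

theorem nodup_leaves (T : Tm) : (leaves T).Nodup :=
  (pairwise_leftDiv_cut T).imp fun h he => h.not_ldCon (by rw [he]; exact ldCon.refl _)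

/-! ### Normal terms -/

/-- `S` is the cut of `T` at some leaf. -/
def IsCut (S T : Tm) : Prop := ∃ α, IsLeaf T α ∧ cut T α = S

theorem IsIterLeftSubterm.isCut {S T : Tm} (h : IsIterLeftSubterm S T) : IsCut S T := by
  obtain ⟨r, s, h⟩ := isIterLeftSubterm_iff_cut.1 h
  exact ⟨_, h⟩

theorem IsCut.of_isIterLeftSubterm {R S T : Tm} (h : IsCut R S) (hS : IsIterLeftSubterm S T) :
    IsCut R T := by
  induction hS with
  | refl => exact h
  | tail _ hU ih =>
    obtain ⟨U, rfl⟩ := hU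
    obtain ⟨α, hα⟩ := ih
    exact ⟨false :: α, hα⟩

theorem isCut_rightPow_iff {n : ℕ} (hn : 1 ≤ n) {S : Tm} :
    IsCut S (rightPow n) ↔ ∃ i : ℕ, 1 ≤ i ∧ i ≤ n ∧ S = rightPow i := by
  induction n, hn using Nat.le_induction generalizing S with
  | base =>
    constructor
    · rintro ⟨α, _, rfl⟩
      exact ⟨1, le_rfl, le_rfl, rfl⟩
    · rintro ⟨i, h₁, h₂, rfl⟩
      obtain rfl := le_antisymm h₂ h₁
      exact ⟨[], rfl, rfl⟩
  | succ n hn ih =>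
    rw [rightPow_succ hn]
    constructor
    · rintro ⟨α, hα, rfl⟩
      rcases isLeaf_mul_iff.1 hα with ⟨β, rfl, hβ⟩ | ⟨β, rfl, hβ⟩
      · exact ⟨1, le_rfl, by omega, rfl⟩
      · obtain ⟨i, h₁, h₂, h⟩ := ih.1 ⟨β, hβ, rfl⟩
        exact ⟨i + 1, by omega, by omega, by rw [cut_mul_true, h, rightPow_succ h₁]⟩
    · rintro ⟨i, h₁, h₂, rfl⟩
      obtain ⟨_ | i, rfl⟩ := Nat.exists_eq_add_of_le' h₁
      · exact ⟨[false], rfl, rfl⟩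
      · obtain ⟨α, hα, h⟩ := ih.2 ⟨i + 1, by omega, by omega, rfl⟩
        exact ⟨true :: α, hα, by rw [cut_mul_true, h, rightPow_succ i.succ_pos]⟩

theorem IsIterLeftSubterm.trans {R S T : Tm} (h : IsIterLeftSubterm R S)
    (h' : IsIterLeftSubterm S T) : IsIterLeftSubterm R T :=
  Relation.ReflTransGen.trans h h'

theorem isIterLeftSubterm_otimes (S T : Tm) : IsIterLeftSubterm S (otimes S T) :=
  termInduction T (Relation.ReflTransGen.single ⟨var, rfl⟩) fun _ _ ih _ => ih.mul_right _

theorem IsIterLeftSubterm.otimes {A B : Tm} (S : Tm) (h : IsIterLeftSubterm A B) :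
    IsIterLeftSubterm (otimes S A) (otimes S B) := by
  refine Relation.ReflTransGen.lift (SelfDistr.otimes S) ?_ _ _ h
  rintro A _ ⟨U, rfl⟩
  exact ⟨SelfDistr.otimes S U, rfl⟩

theorem IsIterLeftSubterm.der {A B : Tm} (h : IsIterLeftSubterm A B) :
    IsIterLeftSubterm (der A) (der B) := by
  induction h with
  | refl => exact Relation.ReflTransGen.refl
  | tail _ hU ih =>
    obtain ⟨U, rfl⟩ := hU
    exact ih.trans (isIterLeftSubterm_otimes _ _)

theorem isIterLeftSubterm_der_rightPow {n : ℕ} (hn : 1 ≤ n) :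
    IsIterLeftSubterm (der (rightPow n)) (der (rightPow (n + 1))) := by
  induction n, hn using Nat.le_induction with
  | base => exact isIterLeftSubterm_otimes var var
  | succ n hn ih =>
    rw [rightPow_succ (by omega : 1 ≤ n + 1), der_mul]
    conv_lhs => rw [rightPow_succ hn, der_mul]
    exact ih.otimes _

theorem isIterLeftSubterm_derPow {p : ℕ} (hp : 1 ≤ p) {m n : ℕ} (hm : 1 ≤ m) (hmn : m ≤ n) :
    IsIterLeftSubterm (derPow p m) (derPow p n) := by
  induction p, hp using Nat.le_induction with
  | base =>
    induction n, hmn using Nat.le_induction with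
    | base => exact Relation.ReflTransGen.refl
    | succ n hn ih => exact ih.trans (isIterLeftSubterm_der_rightPow (hm.trans hn))
  | succ p _ ih =>
    simp only [derPow, Function.iterate_succ_apply'] at ih ⊢
    exact ih.der

theorem IsCut.derPow_mono {p m n : ℕ} (hm : 1 ≤ m) (hmn : m ≤ n) {S : Tm}
    (h : IsCut S (derPow p m)) : IsCut S (derPow p n) := by
  rcases Nat.eq_zero_or_pos p with rfl | hp
  · obtain ⟨i, h₁, h₂, h⟩ := (isCut_rightPow_iff hm).1 h
    exact (isCut_rightPow_iff (hm.trans hmn)).2 ⟨i, h₁, h₂.trans hmn, h⟩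
  · exact h.of_isIterLeftSubterm (isIterLeftSubterm_derPow hp hm hmn)

/-- Two LD-equivalent cuts of terms `∂^p x^[m]` and `∂^p x^[n]` with the same `p` are equal,
because both are cuts of `∂^p x^[max m n]`. -/
theorem OccursCut.eq_of_ldCon {p : ℕ} {S T : Tm} (hS : OccursCut p S) (hT : OccursCut p T)
    (h : ldCon S T) : S = T := by
  obtain ⟨m, hm, hS⟩ := hS
  obtain ⟨n, hn, hT⟩ := hT
  obtain ⟨α, hα, rfl⟩ := IsCut.derPow_mono hm (le_max_left m n) hS
  obtain ⟨β, hβ, rfl⟩ := IsCut.derPow_mono hn (le_max_right m n) hT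
  rw [eq_of_ldCon_cut hα hβ h]

theorem OccursLeft.occursCut {p : ℕ} {T : Tm} (h : OccursLeft p T) : OccursCut p T := by
  obtain ⟨n, hn, h⟩ := h
  exact ⟨n, hn, h.isCut⟩

/-- Existence and uniqueness of representatives of minimal level, for any way `Occ` of occurring
at a level. -/
theorem existsUnique_minimal_level {Occ : ℕ → Tm → Prop}
    (hex : ∀ T, ∃ p S, ldCon T S ∧ Occ p S)
    (huniq : ∀ {p S T}, Occ p S → Occ p T → ldCon S T → S = T) (T : Tm) :
    ∃! N, (∃ p, Occ p N ∧ ∀ q S, ldCon N S → Occ q S → p ≤ q) ∧ ldCon T N := by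
  classical
  obtain ⟨N, hTN, hN⟩ := Nat.find_spec (hex T)
  refine ⟨N, ⟨⟨_, hN, fun q S hS hq => Nat.find_min' (hex T) ⟨S, ldCon.trans hTN hS, hq⟩⟩, hTN⟩,
    ?_⟩
  rintro M ⟨⟨p, hM, hmin⟩, hTM⟩
  have hMN : ldCon M N := ldCon.trans (ldCon.symm hTM) hTN
  have hp : p = Nat.find (hex T) :=
    le_antisymm (hmin _ N hMN hN) (Nat.find_min' (hex T) ⟨M, hTM, hM⟩)
  subst hp
  exact huniq hM hN hMN

/-! ### Cuts of the derived term -/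

/-- The iterated left multiplication `A₁ * (A₂ * (⋯ * (Aₖ * X)))` by a list of terms. -/
def leftAct (u : List Tm) (X : Tm) : Tm := u.foldr (· * ·) X

theorem leftAct_cons (A : Tm) (u : List Tm) (X : Tm) : leftAct (A :: u) X = A * leftAct u X := rfl

theorem leftAct_append (u v : List Tm) (X : Tm) :
    leftAct (u ++ v) X = leftAct u (leftAct v X) := List.foldr_append

theorem leftAct_congr {ι : Type*} {f g : ι → Tm} (h : ∀ i, ldCon (f i) (g i)) (l : List ι)
    {X Y : Tm} (hXY : ldCon X Y) : ldCon (leftAct (l.map f) X) (leftAct (l.map g) Y) := by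
  induction l with
  | nil => exact hXY
  | cons i l ih => exact ldCon.mul (h i) ih

theorem rightProd_cons (A : Tm) {u : List Tm} (hu : u ≠ []) :
    rightProd (A :: u) = A * rightProd u := by
  obtain ⟨B, v, rfl⟩ := List.exists_cons_of_ne_nil hu
  rfl

theorem rightProd_append (u : List Tm) {v : List Tm} (hv : v ≠ []) :
    rightProd (u ++ v) = leftAct u (rightProd v) := by
  induction u with
  | nil => rfl
  | cons A u ih => rw [List.cons_append, rightProd_cons A (by simp [hv]), ih, leftAct_cons]

theorem rightProd_map_congr {f g : Tm → Tm} (h : ∀ A, ldCon (f A) (g A)) (u : List Tm) :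
    ldCon (rightProd (u.map f)) (rightProd (u.map g)) := by
  rcases List.eq_nil_or_concat u with rfl | ⟨v, A, rfl⟩
  · exact ldCon.refl _
  · simp only [List.concat_eq_append, List.map_append, List.map_singleton]
    rw [rightProd_append _ (List.cons_ne_nil _ _), rightProd_append _ (List.cons_ne_nil _ _)]
    exact leftAct_congr h v (h A)

theorem rightProd_map_mul (T : Tm) {u : List Tm} (hu : u ≠ []) :
    ldCon (rightProd (u.map (T * ·))) (T * rightProd u) := by
  induction u with
  | nil => exact absurd rfl hu
  | cons A u ih =>
    rcases eq_or_ne u [] with rfl | hu'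
    · exact ldCon.refl _
    · rw [List.map_cons, rightProd_cons _ (by simpa using hu'), rightProd_cons _ hu']
      exact ldCon.trans (ldCon.mul (ldCon.refl _) (ih hu')) (ldCon.symm (ldCon_dist _ _ _))

/-- `f` induces an endomorphism of the free shelf. -/
structure IsLDEndo (f : Tm → Tm) : Prop where
  congr {A B : Tm} : ldCon A B → ldCon (f A) (f B)
  map_mul (A B : Tm) : ldCon (f (A * B)) (f A * f B)

theorem IsLDEndo.id : IsLDEndo id := ⟨fun h => h, fun _ _ => ldCon.refl _⟩

theorem IsLDEndo.comp_mul_left {f : Tm → Tm} (hf : IsLDEndo f) (T : Tm) :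
    IsLDEndo fun A => f (T * A) :=
  ⟨fun h => hf.congr (ldCon.mul (ldCon.refl T) h),
    fun A B => ldCon.trans (hf.congr (ldCon_dist T A B)) (hf.map_mul _ _)⟩

/-- The lists `u` and `v` have LD-equivalent right products, and they act in the same way by
iterated left multiplication, even after an endomorphism is applied to their entries. The right
product of a list is not determined by its action: `[A * B, A]` acts like `[A, B]`. -/
structure SameAction (u v : List Tm) : Prop where
  nil_iff : u = [] ↔ v = []
  prod : ldCon (rightProd u) (rightProd v)
  act {f : Tm → Tm} : IsLDEndo f → ∀ X, ldCon (leftAct (u.map f) X) (leftAct (v.map f) X)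

theorem SameAction.nil : SameAction [] [] :=
  ⟨Iff.rfl, ldCon.refl _, fun _ _ => ldCon.refl _⟩

theorem SameAction.singleton {A B : Tm} (h : ldCon A B) : SameAction [A] [B] :=
  ⟨by simp, h, fun hf X => ldCon.mul (hf.congr h) (ldCon.refl X)⟩

/-- Compatibility of `SameAction` with the recursive description of the contexts of leaves of
`S ⊗ ∂T₁`, where `S` is LD-equivalent to `T`. -/
theorem SameAction.append {S T : Tm} (hST : ldCon S T) {u v u' v' : List Tm}
    (h : SameAction u v) (h' : SameAction u' v') :
    SameAction (u.map (otimes S) ++ u') (v.map (T * ·) ++ v') := by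
  have hS : ∀ A, ldCon (otimes S A) (T * A) := fun A =>
    ldCon.trans (ldCon.symm (mul_expands_otimes S A).ldCon) (ldCon.mul hST (ldCon.refl A))
  have hact : ∀ {f : Tm → Tm}, IsLDEndo f → ∀ {X Y : Tm}, ldCon X Y →
      ldCon (leftAct ((u.map (otimes S)).map f) X) (leftAct ((v.map (T * ·)).map f) Y) := by
    intro f hf X Y hXY
    rw [List.map_map, List.map_map]
    exact ldCon.trans (leftAct_congr (fun A => hf.congr (hS A)) u hXY)
      (h.act (hf.comp_mul_left T) Y)
  refine ⟨by simp [h.nil_iff, h'.nil_iff], ?_, fun {f} hf X => ?_⟩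
  · rcases eq_or_ne u' [] with rfl | hu'
    · obtain rfl := h'.nil_iff.1 rfl
      rw [List.append_nil, List.append_nil]
      refine ldCon.trans (rightProd_map_congr hS u) ?_
      rcases eq_or_ne u [] with rfl | hu
      · obtain rfl := h.nil_iff.1 rfl
        exact ldCon.refl _
      · have hv : v ≠ [] := fun hv => hu (h.nil_iff.2 hv)
        exact ldCon.trans (rightProd_map_mul T hu) (ldCon.trans
          (ldCon.mul (ldCon.refl T) h.prod) (ldCon.symm (rightProd_map_mul T hv)))
    · have hv' : v' ≠ [] := fun hv => hu' (h'.nil_iff.2 hv)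
      rw [rightProd_append _ hu', rightProd_append _ hv']
      simpa only [List.map_id] using hact IsLDEndo.id h'.prod
  · rw [List.map_append, List.map_append, leftAct_append, leftAct_append]
    exact hact hf (h'.act hf X)

/-- The contexts of the leaves of `T`, from left to right: the context of a leaf is the list of the
terms `A₁, …, Aₖ` such that the cut at this leaf is `A₁ * (A₂ * (⋯ * (Aₖ * x)))`. -/
def contexts : Tm → List (List Tm)
  | FreeMagma.of _ => [[]]
  | FreeMagma.mul T₀ T₁ => contexts T₀ ++ (contexts T₁).map (T₀ :: ·)

theorem contexts_mul (T₀ T₁ : Tm) :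
    contexts (T₀ * T₁) = contexts T₀ ++ (contexts T₁).map (T₀ :: ·) := rfl

theorem exists_contexts_eq_cons (T : Tm) : ∃ l, contexts T = [] :: l ∧ ∀ u ∈ l, u ≠ [] := by
  refine termInduction T ⟨[], rfl, by simp⟩ ?_
  rintro T₀ T₁ ⟨l, hl, hne⟩ _
  refine ⟨l ++ (contexts T₁).map (T₀ :: ·), by rw [contexts_mul, hl, List.cons_append], ?_⟩
  intro u hu
  rcases List.mem_append.1 hu with hu | hu
  · exact hne u hu
  · obtain ⟨v, _, rfl⟩ := List.mem_map.1 hu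
    exact List.cons_ne_nil _ _

/-- The cut at a leaf other than the last one is the right product of the context of the next
leaf. -/
theorem map_cut_leaves (T : Tm) :
    (leaves T).map (cut T) = (contexts T).tail.map rightProd ++ [T] := by
  refine termInduction T rfl fun T₀ T₁ ih₀ ih₁ => ?_
  obtain ⟨l₀, hl₀, _⟩ := exists_contexts_eq_cons T₀
  obtain ⟨l₁, hl₁, hne⟩ := exists_contexts_eq_cons T₁
  have h₀ : ((leaves T₀).map (false :: ·)).map (cut (T₀ * T₁)) = l₀.map rightProd ++ [T₀] := by
    rw [List.map_map]
    exact ih₀.trans (by rw [hl₀, List.tail_cons])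
  have h₁ : ((leaves T₁).map (true :: ·)).map (cut (T₀ * T₁)) =
      (l₁.map rightProd ++ [T₁]).map (T₀ * ·) := by
    rw [List.map_map, ← List.tail_cons (a := []) (as := l₁), ← hl₁, ← ih₁, List.map_map]
    rfl
  have h₂ : l₁.map (rightProd ∘ (T₀ :: ·)) = l₁.map ((T₀ * ·) ∘ rightProd) :=
    List.map_congr_left fun u hu => rightProd_cons T₀ (hne u hu)
  rw [leaves_mul, List.map_append, h₀, h₁, contexts_mul, hl₀, hl₁]
  simp only [List.cons_append, List.tail_cons, List.map_append, List.map_cons, List.map_map, h₂,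
    List.map_nil, List.append_assoc, List.nil_append]
  rfl

theorem contexts_otimes (S T : Tm) : contexts (otimes S T) =
    (contexts T).flatMap fun u => (contexts S ++ [[S]]).map (u.map (otimes S) ++ ·) := by
  refine termInduction T ?_ fun T₀ T₁ ih₀ ih₁ => ?_
  · show contexts S ++ [[S]] = List.flatMap _ [[]]
    simp
  · rw [otimes_mul, contexts_mul, contexts_mul, ih₀, ih₁, List.flatMap_append, List.map_flatMap,
      List.flatMap_map]
    simp only [List.map_map, List.map_cons]
    rfl

/-- The descents of `T` that avoid its rightmost leaf, and the empty sequence, in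
lexicographic order. -/
def innerDescents : Tm → List (List Addr)
  | FreeMagma.of _ => [[]]
  | FreeMagma.mul T₀ T₁ => (innerDescents T₁).flatMap fun D =>
      (innerDescents T₀ ++ [[rightmost T₀]]).map (D.map (true :: ·) ++ ·.map (false :: ·))

theorem innerDescents_mul (T₀ T₁ : Tm) : innerDescents (T₀ * T₁) =
    (innerDescents T₁).flatMap fun D =>
      (innerDescents T₀ ++ [[rightmost T₀]]).map (D.map (true :: ·) ++ ·.map (false :: ·)) := rfl

/-- The leaves of `∂T` correspond, in order, to the possibly empty descents of `T` that avoid the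
rightmost leaf, so that the context of a leaf acts like the list of the cuts along the descent. -/
theorem forall₂_contexts_innerDescents (T : Tm) :
    List.Forall₂ (fun u D => SameAction u (D.map (cut T))) (contexts (der T))
      (innerDescents T) := by
  refine termInduction T (.cons SameAction.nil .nil) fun T₀ T₁ ih₀ ih₁ => ?_
  rw [der_mul, contexts_otimes, innerDescents_mul]
  refine List.rel_flatMap ih₁ fun u D huD => ?_
  have hder : ldCon (der T₀) T₀ := ldCon.symm (expands_der T₀).ldCon
  have ih₀' : List.Forall₂ (fun u D => SameAction u (D.map (cut T₀)))
      (contexts (der T₀) ++ [[der T₀]]) (innerDescents T₀ ++ [[rightmost T₀]]) := by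
    refine List.rel_append ih₀ (.cons ?_ .nil)
    rw [List.map_singleton, cut_rightmost]
    exact SameAction.singleton hder
  refine List.rel_map (fun u' E hE => ?_) ih₀'
  have := SameAction.append hder huD hE
  rw [List.map_map] at this
  rw [List.map_append, List.map_map, List.map_map]
  exact this

/-- All descents of `T`, in lexicographic order. -/
def descents (T : Tm) : List (List Addr) := (innerDescents T).tail ++ [[rightmost T]]

theorem exists_innerDescents_eq_cons (T : Tm) :
    ∃ l, innerDescents T = [] :: l ∧ ∀ D ∈ l, D ≠ [] := by
  obtain ⟨l, hl, hne⟩ := exists_contexts_eq_cons (der T)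
  have h := forall₂_contexts_innerDescents T
  rw [hl] at h
  obtain ⟨D, m, hD, hm, he⟩ := List.forall₂_cons_left_iff.1 h
  refine ⟨m, by rw [he, List.map_eq_nil_iff.1 (hD.nil_iff.1 rfl)], ?_⟩
  clear he hl h
  induction hm with
  | nil => simp
  | cons h _ ih =>
    rw [List.forall_mem_cons] at hne ⊢
    exact ⟨fun hE => hne.1 (h.nil_iff.2 (by rw [hE, List.map_nil])), ih hne.2⟩

theorem forall₂_leaves_descents (T : Tm) :
    List.Forall₂ (fun α D => ldCon (cut (der T) α) (rightProd (D.map (cut T))))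
      (leaves (der T)) (descents T) := by
  have h := forall₂_contexts_innerDescents T
  obtain ⟨l, hl, -⟩ := exists_contexts_eq_cons (der T)
  obtain ⟨m, hm, -⟩ := exists_innerDescents_eq_cons T
  rw [hl, hm] at h
  have key : List.Forall₂ (fun A D => ldCon A (rightProd (D.map (cut T))))
      ((leaves (der T)).map (cut (der T))) (descents T) := by
    rw [map_cut_leaves, descents, hl, hm, List.tail_cons, List.tail_cons]
    refine List.rel_append ?_ (.cons ?_ .nil)
    · exact List.forall₂_map_left_iff.2 ((List.forall₂_cons.1 h).2.imp fun _ _ h => h.prod)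
    · rw [List.map_singleton, cut_rightmost]
      exact ldCon.symm (expands_der T).ldCon
  exact List.forall₂_map_left_iff.1 key

theorem descends_true_true_iff {α β : Addr} :
    Descends (true :: α) (true :: β) ↔ Descends α β := by
  constructor
  · rintro ⟨_ | ⟨b, γ⟩, δ, ε, p, hp, h₁, h₂⟩
    · cases h₂
    · simp only [List.cons_append, List.cons.injEq] at h₁ h₂
      exact ⟨γ, δ, ε, p, hp, h₁.2, h₂.2⟩
  · rintro ⟨γ, δ, ε, p, hp, rfl, rfl⟩
    exact ⟨true :: γ, δ, ε, p, hp, rfl, rfl⟩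

theorem descends_false_false_iff {α β : Addr} :
    Descends (false :: α) (false :: β) ↔ Descends α β := by
  constructor
  · rintro ⟨_ | ⟨b, γ⟩, δ, ε, p, hp, h₁, h₂⟩
    · obtain ⟨p, rfl⟩ := Nat.exists_eq_add_of_le' hp
      cases h₁
    · simp only [List.cons_append, List.cons.injEq] at h₁ h₂
      exact ⟨γ, δ, ε, p, hp, h₁.2, h₂.2⟩
  · rintro ⟨γ, δ, ε, p, hp, rfl, rfl⟩
    exact ⟨false :: γ, δ, ε, p, hp, rfl, rfl⟩

theorem not_descends_false_true {α β : Addr} : ¬ Descends (false :: α) (true :: β) := by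
  rintro ⟨_ | ⟨b, γ⟩, δ, ε, p, hp, h₁, h₂⟩
  · cases h₂
  · simp only [List.cons_append, List.cons.injEq] at h₁ h₂
    exact absurd (h₁.1.trans h₂.1.symm) (by decide)

/-- Both members of a descent step leave the right branch of the tree. -/
theorem Descends.false_mem {α β : Addr} (h : Descends α β) : false ∈ α ∧ false ∈ β := by
  obtain ⟨γ, δ, ε, p, -, rfl, rfl⟩ := h
  simp

theorem false_notMem_rightmost (T : Tm) : false ∉ rightmost T := by
  obtain ⟨s, hs⟩ := exists_replicate_eq_rightmost T
  simp [← hs]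

theorem descends_true_false_iff {T : Tm} {α : Addr} (hα : IsLeaf T α) (β : Addr) :
    Descends (true :: α) (false :: β) ↔ α ≠ rightmost T := by
  constructor
  · rintro h rfl
    exact false_notMem_rightmost T (by simpa using h.false_mem.1)
  · intro h
    suffices ∃ p ε, α = List.replicate p true ++ false :: ε by
      obtain ⟨p, ε, rfl⟩ := this
      exact ⟨[], β, ε, p + 1, by omega, rfl, rfl⟩
    induction T using termInduction generalizing α with
    | hvar => exact absurd hα h
    | hmul T₀ T₁ _ ih =>
      rcases isLeaf_mul_iff.1 hα with ⟨γ, rfl, hγ⟩ | ⟨γ, rfl, hγ⟩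
      · exact ⟨0, γ, rfl⟩
      · obtain ⟨p, ε, rfl⟩ := ih hγ fun he => h (by rw [he, rightmost_mul])
        exact ⟨p + 1, ε, rfl⟩

/-- A descent through the rightmost leaf is reduced to it. -/
theorem eq_singleton_of_rightmost_mem {T : Tm} {D : List Addr} (hD : D.IsChain Descends)
    (h : rightmost T ∈ D) : D = [rightmost T] := by
  have hT := false_notMem_rightmost T
  match D, hD, h with
  | [α], _, h => rw [List.mem_singleton.1 h]
  | α :: β :: D, hD, h =>
    exfalso
    induction D generalizing α β with
    | nil =>
      have := (List.isChain_cons_cons.1 hD).1.false_mem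
      simp only [List.mem_cons, List.not_mem_nil, or_false] at h
      rcases h with h | h <;> rw [h] at hT
      exacts [hT this.1, hT this.2]
    | cons γ D ih =>
      obtain ⟨h₁, h₂⟩ := List.isChain_cons_cons.1 hD
      rcases List.mem_cons.1 h with h | h
      · rw [h] at hT
        exact hT h₁.false_mem.1
      · exact ih β γ h₂ h

/-- A chain of leaves of `T₀ * T₁` visits leaves of `T₁` first, and leaves of `T₀` afterwards. -/
theorem exists_eq_append_of_isChain {T₀ T₁ : Tm} {D : List Addr}
    (hl : ∀ α ∈ D, IsLeaf (T₀ * T₁) α) (hc : D.IsChain Descends) :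
    ∃ D₁ E : List Addr, D = D₁.map (true :: ·) ++ E.map (false :: ·) := by
  induction D with
  | nil => exact ⟨[], [], rfl⟩
  | cons α D ih =>
    obtain ⟨D₁, E, rfl⟩ := ih (fun β hβ => hl β (List.mem_cons_of_mem _ hβ)) hc.tail
    rcases isLeaf_mul_iff.1 (hl α List.mem_cons_self) with ⟨β, rfl, -⟩ | ⟨β, rfl, -⟩
    · rcases D₁ with _ | ⟨γ, D₁⟩
      · exact ⟨[], β :: E, rfl⟩
      · exact absurd (List.isChain_cons_cons.1 hc).1 not_descends_false_true
    · exact ⟨β :: D₁, E, rfl⟩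

theorem isChain_append_iff {T₁ : Tm} {D E : List Addr} (hl : ∀ α ∈ D, IsLeaf T₁ α)
    (hr : rightmost T₁ ∉ D) :
    (D.map (true :: ·) ++ E.map (false :: ·)).IsChain Descends ↔
      D.IsChain Descends ∧ E.IsChain Descends := by
  rw [List.isChain_append, List.isChain_map, List.isChain_map]
  simp only [descends_true_true_iff, descends_false_false_iff]
  refine ⟨fun h => ⟨h.1, h.2.1⟩, fun h => ⟨h.1, h.2, ?_⟩⟩
  intro α hα β hβ
  rw [List.getLast?_map] at hα
  rw [List.head?_map] at hβ
  obtain ⟨γ, hγ, rfl⟩ := Option.map_eq_some_iff.1 hα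
  obtain ⟨δ, -, rfl⟩ := Option.map_eq_some_iff.1 hβ
  have hγD := List.mem_of_getLast? hγ
  exact (descends_true_false_iff (hl γ hγD) δ).2 fun h => hr (h ▸ hγD)

theorem mem_innerDescents_append_iff {T : Tm}
    (h : ∀ D, D ∈ innerDescents T ↔
      (∀ α ∈ D, IsLeaf T α) ∧ D.IsChain Descends ∧ rightmost T ∉ D) (D : List Addr) :
    D ∈ innerDescents T ++ [[rightmost T]] ↔ (∀ α ∈ D, IsLeaf T α) ∧ D.IsChain Descends := by
  rw [List.mem_append, List.mem_singleton, h]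
  constructor
  · rintro (h | rfl)
    · exact ⟨h.1, h.2.1⟩
    · exact ⟨by simpa using isLeaf_rightmost T, List.isChain_singleton _⟩
  · rintro ⟨h₁, h₂⟩
    by_cases hr : rightmost T ∈ D
    · exact Or.inr (eq_singleton_of_rightmost_mem h₂ hr)
    · exact Or.inl ⟨h₁, h₂, hr⟩

theorem mem_innerDescents {T : Tm} : ∀ D, D ∈ innerDescents T ↔
    (∀ α ∈ D, IsLeaf T α) ∧ D.IsChain Descends ∧ rightmost T ∉ D := by
  refine termInduction T (fun D => ?_) fun T₀ T₁ ih₀ ih₁ D => ?_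
  · refine List.mem_singleton.trans ⟨?_, fun h => ?_⟩
    · rintro rfl
      simp
    · refine List.eq_nil_iff_forall_not_mem.2 fun α hα => h.2.2 ?_
      have : α = rightmost var := h.1 α hα
      rwa [← this]
  · have leaf_iff : ∀ D₁ E : List Addr,
        (∀ α ∈ D₁.map (true :: ·) ++ E.map (false :: ·), IsLeaf (T₀ * T₁) α) ↔
          (∀ α ∈ D₁, IsLeaf T₁ α) ∧ ∀ α ∈ E, IsLeaf T₀ α := by
      intro D₁ E
      simp [List.mem_append, or_imp, forall_and, isLeaf_mul_iff]
    have mem_iff : ∀ D₁ E : List Addr,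
        rightmost (T₀ * T₁) ∈ D₁.map (true :: ·) ++ E.map (false :: ·) ↔
          rightmost T₁ ∈ D₁ := by
      intro D₁ E
      simp [rightmost_mul]
    rw [innerDescents_mul, List.mem_flatMap]
    simp only [List.mem_map, mem_innerDescents_append_iff ih₀]
    constructor
    · rintro ⟨D₁, hD₁, E, hE, rfl⟩
      obtain ⟨h₁, h₂, h₃⟩ := (ih₁ D₁).1 hD₁
      rw [leaf_iff, mem_iff, isChain_append_iff h₁ h₃]
      exact ⟨⟨h₁, hE.1⟩, ⟨h₂, hE.2⟩, h₃⟩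
    · rintro ⟨hl, hc, hr⟩
      obtain ⟨D₁, E, rfl⟩ := exists_eq_append_of_isChain hl hc
      rw [leaf_iff] at hl
      rw [mem_iff] at hr
      rw [isChain_append_iff hl.1 hr] at hc
      exact ⟨D₁, (ih₁ D₁).2 ⟨hl.1, hc.1, hr⟩, E, ⟨hl.2, hc.2⟩, rfl⟩

theorem mem_descents {T : Tm} {D : List Addr} : D ∈ descents T ↔ IsDescent T D := by
  obtain ⟨l, hl, hne⟩ := exists_innerDescents_eq_cons T
  have h := mem_innerDescents_append_iff (T := T) mem_innerDescents D
  rw [hl, List.cons_append, List.mem_cons] at h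
  rw [descents, hl, List.tail_cons, IsDescent, ← h]
  constructor
  · intro hD
    refine ⟨?_, Or.inr hD⟩
    rintro rfl
    rcases List.mem_append.1 hD with hD | hD
    · exact hne _ hD rfl
    · simp at hD
  · rintro ⟨h₁, h₂⟩
    exact h₂.resolve_left h₁

/-- Equal entries of `descents T` would belong to different leaves of `∂T` with LD-equivalent
cuts. -/
theorem nodup_descents (T : Tm) : (descents T).Nodup := by
  obtain ⟨hlen, h⟩ := List.forall₂_iff_get.1 (forall₂_leaves_descents T)
  rw [List.nodup_iff_injective_get]
  intro i j hij
  have hi := h i (by rw [hlen]; exact i.2) i.2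
  have hj := h j (by rw [hlen]; exact j.2) j.2
  simp only [Fin.eta] at hi hj
  rw [← hij] at hj
  have he := eq_of_ldCon_cut (mem_leaves.1 (List.get_mem _ _)) (mem_leaves.1 (List.get_mem _ _))
    (ldCon.trans hi (ldCon.symm hj))
  have := (List.nodup_iff_injective_get.1 (nodup_leaves (der T))) he
  simpa [Fin.ext_iff] using this

/-- The bijection that sends the `i`-th leaf of `∂T` to the `i`-th descent of `T` in
lexicographic order. -/
def leafDescentEquiv (T : Tm) : {α : Addr // IsLeaf (der T) α} ≃ {l : List Addr // IsDescent T l} :=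
  (Equiv.subtypeEquivRight fun _ => mem_leaves.symm).trans
    (((nodup_leaves (der T)).getEquiv _).symm.trans
      ((finCongr (forall₂_leaves_descents T).length_eq).trans
        (((nodup_descents T).getEquiv _).trans
          (Equiv.subtypeEquivRight fun _ => mem_descents))))

theorem ldCon_cut_leafDescentEquiv (T : Tm) (α : {α : Addr // IsLeaf (der T) α}) :
    ldCon (cut (der T) α.1) (rightProd ((leafDescentEquiv T α).1.map (cut T))) := by
  obtain ⟨_, h⟩ := List.forall₂_iff_get.1 (forall₂_leaves_descents T)
  set i := ((nodup_leaves (der T)).getEquiv _).symm ⟨α.1, mem_leaves.2 α.2⟩ with hi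
  have hα : (leaves (der T)).get i = α.1 :=
    congrArg Subtype.val (((nodup_leaves (der T)).getEquiv _).apply_symm_apply _)
  have := h i i.2 ((forall₂_leaves_descents T).length_eq ▸ i.2)
  simp only [Fin.eta] at this
  rw [hα] at this
  exact this

end SelfDistr

open SelfDistr in
theorem mainTheorem6 :
    -- every term is LD-equivalent to a unique normal term
    (∀ T : SelfDistr.Tm, ∃! N : SelfDistr.Tm, SelfDistr.IsNormal N ∧ SelfDistr.ldCon T N) ∧
    -- the same with cuts in place of iterated left subterms
    (∀ T : SelfDistr.Tm, ∃! N : SelfDistr.Tm, SelfDistr.IsCutNormal N ∧ SelfDistr.ldCon T N) ∧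
    -- the iterated left subterms are the cuts at the leaves with address `0^r 1^s`
    (∀ S T : SelfDistr.Tm, SelfDistr.IsIterLeftSubterm S T ↔
      ∃ r s : ℕ, SelfDistr.IsLeaf T (List.replicate r false ++ List.replicate s true) ∧
        SelfDistr.cut T (List.replicate r false ++ List.replicate s true) = S) ∧
    -- the cuts of `x^[n]` are the terms `x^[i]` with `1 ≤ i ≤ n`
    (∀ n : ℕ, 1 ≤ n → ∀ S : SelfDistr.Tm,
      (∃ α : SelfDistr.Addr, SelfDistr.IsLeaf (SelfDistr.rightPow n) α ∧
        SelfDistr.cut (SelfDistr.rightPow n) α = S) ↔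
      ∃ i : ℕ, 1 ≤ i ∧ i ≤ n ∧ S = SelfDistr.rightPow i) ∧
    -- different leaves give different cuts
    (∀ (T : SelfDistr.Tm) (α β : SelfDistr.Addr), SelfDistr.IsLeaf T α → SelfDistr.IsLeaf T β →
      SelfDistr.cut T α = SelfDistr.cut T β → α = β) ∧
    -- the cuts of `∂T` correspond to the descents of `T`
    (∀ T : SelfDistr.Tm,
      ∃! φ : {α : SelfDistr.Addr // SelfDistr.IsLeaf (SelfDistr.der T) α} ≃
          {l : List SelfDistr.Addr // SelfDistr.IsDescent T l},
        ∀ α, SelfDistr.ldCon (SelfDistr.cut (SelfDistr.der T) α.1)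
          (SelfDistr.rightProd ((φ α).1.map (SelfDistr.cut T)))) := by
  refine ⟨existsUnique_minimal_level exists_occursLeft
      fun hS hT => hS.occursCut.eq_of_ldCon hT.occursCut,
    existsUnique_minimal_level ?_ fun hS hT => hS.eq_of_ldCon hT,
    fun _ _ => isIterLeftSubterm_iff_cut, fun n hn S => isCut_rightPow_iff hn, ?_, ?_⟩
  · intro T
    obtain ⟨p, S, h, hS⟩ := exists_occursLeft T
    exact ⟨p, S, h, hS.occursCut⟩
  · intro T α β hα hβ h
    exact eq_of_ldCon_cut hα hβ (h ▸ ldCon.refl _)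
  · intro T
    refine ⟨leafDescentEquiv T, ldCon_cut_leafDescentEquiv T, fun φ hφ => Equiv.ext fun α => ?_⟩
    -- The leaf that `leafDescentEquiv T` sends to `φ α` has a cut equivalent to that of `α`.
    have h := ldCon_cut_leafDescentEquiv T ((leafDescentEquiv T).symm (φ α))
    rw [Equiv.apply_symm_apply] at h
    have he := eq_of_ldCon_cut α.2 ((leafDescentEquiv T).symm (φ α)).2
      (ldCon.trans (hφ α) (ldCon.symm h))
    rw [← Equiv.symm_apply_eq]
    exact (Subtype.ext he).symm
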